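/- Let $C$ be a smooth projective (integral) curve over $\mathbb{C}$ with canonical bundle $K_C$ and tangent bundle $T_C = K_C^*$, and let $E$ be a vector bundle of rank $r$ on $C$ with $h^0(C,E) = r+1$, such that both $E$ and $K_C \otimes E^*$ are globally generated. Put $m = h^0(C, K_C \otimes E^*)$ (so $m = r+1$ if $\deg E = r(g-1)$, where $g$ is the genus of $C$). Let $$\bar\mu \colon H^0(C,E) \otimes H^0(C, K_C \otimes E^*) \longrightarrow H^0(C, K_C \otimes \mathrm{End}\, E) \stackrel{\mathrm{tr}}{\longrightarrow} H^0(C, K_C)$$ be the Petri trace map. Choose bases $(s_i)$ of $H^0(C,E)$ and $(t_j)$ of $H^0(C, K_C \otimes E^*)$, and let $\Lambda = (l_{ij})$ be the $(r+1) \times m$ matrix with entries $l_{ij} = \bar\mu(s_i \otimes t_j) \in H^0(C,K_C)$, regarded as linear forms on the canonical space $|K_C|^* = \mathbb{P}(H^0(C,K_C)^*)$. The restriction of a linear form $l \in H^0(C,K_C)$ to $C$ is the pullback of $l$ under the canonical map, for which $\mathcal{O}(-1)$ pulls back to $T_C$; that is, it is the map $T_C \to \mathcal{O}_C$, $v \mapsto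 l(v)$. Thus the transpose $\Lambda^t$ restricts to a map of $\mathcal{O}_C$-modules $$\Lambda^t|_C \colon T_C^{\oplus m} \longrightarrow \mathcal{O}_C^{\oplus (r+1)}, \qquad (v_j)_j \mapsto \Bigl( \sum_j l_{ij}(v_j) \Bigr)_i,$$ in which $T_C^{\oplus m} = T_C \otimes H^0(C, K_C \otimes E^*)$ and, by Serre duality, $\mathcal{O}_C^{\oplus (r+1)} = \mathcal{O}_C \otimes H^0(C,E)^* \cong \mathcal{O}_C \otimes H^1(C, K_C \otimes E^*)$. Then, for every choice of the bases, the image of $\Lambda^t|_C$ is isomorphic to $E^*$ as an $\mathcal{O}_C$-module. -/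

import Mathlib

open CategoryTheory Limits MonoidalCategory AlgebraicGeometry TopologicalSpace Opposite

noncomputable section

namespace CurveBundles

variable {X : Scheme.{0}}

/-- The structure sheaf `𝒪_X` as an `𝒪_X`-module. -/
abbrev structureSheaf (X : Scheme.{0}) : X.Modules := SheafOfModules.unit X.ringCatSheaf

/-! ### The dual of a sheaf of modules -/

lemma map_map {U V W : X.Opens} (hW : W ≤ V) (hV : V ≤ U) (r : Γ(X, U)) :
    X.presheaf.map (homOfLE hW).op (X.presheaf.map (homOfLE hV).op r) =
      X.presheaf.map (homOfLE (hW.trans hV)).op r := by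
  rw [← CategoryTheory.comp_apply, ← Functor.map_comp]; rfl

lemma modules_map_map (M : X.Modules) {U V W : X.Opens} (hW : W ≤ V) (hV : V ≤ U) (m : Γ(M, U)) :
    M.presheaf.map (homOfLE hW).op (M.presheaf.map (homOfLE hV).op m) =
      M.presheaf.map (homOfLE (hW.trans hV)).op m := by
  rw [← CategoryTheory.comp_apply, ← Functor.map_comp]; rfl

/-- Sections over `U` of the dual `M^* = ℋom(M, 𝒪_X)`: morphisms `M|_U ⟶ 𝒪_U`, that is, families of
`𝒪_X(V)`-linear maps `M(V) → 𝒪_X(V)`, for `V ⊆ U` open, that commute with restriction. -/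
@[ext]
structure DualSection (M : X.Modules) (U : X.Opens) where
  /-- the linear map on sections over `V ⊆ U` -/
  app (V : X.Opens) (hV : V ≤ U) : Γ(M, V) →ₗ[Γ(X, V)] Γ(X, V)
  naturality (V W : X.Opens) (hV : V ≤ U) (hW : W ≤ V) (m : Γ(M, V)) :
    app W (hW.trans hV) (M.presheaf.map (homOfLE hW).op m) =
      X.presheaf.map (homOfLE hW).op (app V hV m)

namespace DualSection

variable {M : X.Modules} {U : X.Opens}

instance : Zero (DualSection M U) := ⟨⟨fun _ _ => 0, fun _ _ _ _ _ => by simp⟩⟩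

instance : Add (DualSection M U) :=
  ⟨fun φ ψ => ⟨fun V hV => φ.app V hV + ψ.app V hV, fun V W hV hW m => by
    simp [φ.naturality V W hV hW, ψ.naturality V W hV hW]⟩⟩

instance : Neg (DualSection M U) :=
  ⟨fun φ => ⟨fun V hV => -φ.app V hV, fun V W hV hW m => by
    simp [φ.naturality V W hV hW]⟩⟩

instance : SMul Γ(X, U) (DualSection M U) :=
  ⟨fun r φ => ⟨fun V hV => X.presheaf.map (homOfLE hV).op r • φ.app V hV, fun V W hV hW m => by
    simp [φ.naturality V W hV hW, ← map_map hW hV r]⟩⟩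

@[simp] lemma zero_app (V : X.Opens) (hV : V ≤ U) :
    (0 : DualSection M U).app V hV = 0 := rfl

@[simp] lemma add_app (φ ψ : DualSection M U) (V : X.Opens) (hV : V ≤ U) :
    (φ + ψ).app V hV = φ.app V hV + ψ.app V hV := rfl

@[simp] lemma neg_app (φ : DualSection M U) (V : X.Opens) (hV : V ≤ U) :
    (-φ).app V hV = -(φ.app V hV) := rfl

@[simp] lemma smul_app (r : Γ(X, U)) (φ : DualSection M U) (V : X.Opens) (hV : V ≤ U) :
    (r • φ).app V hV = X.presheaf.map (homOfLE hV).op r • φ.app V hV := rfl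

lemma ext' {φ ψ : DualSection M U} (h : ∀ V hV, φ.app V hV = ψ.app V hV) : φ = ψ :=
  DualSection.ext (by funext V hV; exact h V hV)

instance : AddCommGroup (DualSection M U) where
  add_assoc _ _ _ := ext' fun _ _ => by simp [add_assoc]
  zero_add _ := ext' fun _ _ => by simp
  add_zero _ := ext' fun _ _ => by simp
  add_comm _ _ := ext' fun _ _ => by simp [add_comm]
  neg_add_cancel _ := ext' fun _ _ => by simp
  nsmul := nsmulRec
  zsmul := zsmulRec

instance : Module Γ(X, U) (DualSection M U) where
  one_smul _ := ext' fun _ _ => by simp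
  mul_smul _ _ _ := ext' fun _ _ => by simp [mul_smul]
  smul_zero _ := ext' fun _ _ => by simp
  smul_add _ _ _ := ext' fun _ _ => by simp
  add_smul _ _ _ := ext' fun _ _ => by simp [add_smul]
  zero_smul _ := ext' fun _ _ => by simp

/-- Restriction of a section of the dual to a smaller open set. -/
def res {U' : X.Opens} (h : U' ≤ U) : DualSection M U →+ DualSection M U' where
  toFun φ := ⟨fun V hV => φ.app V (hV.trans h), fun V W _ hW m => φ.naturality V W _ hW m⟩
  map_zero' := rfl
  map_add' _ _ := rfl

@[simp] lemma res_app {U' : X.Opens} (h : U' ≤ U) (φ : DualSection M U) (V : X.Opens)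
    (hV : V ≤ U') : (res h φ).app V hV = φ.app V (hV.trans h) := rfl

end DualSection

/-- The presheaf of abelian groups `U ↦ Hom(M|_U, 𝒪_U)`. -/
def dualAbPresheaf (M : X.Modules) : X.Opensᵒᵖ ⥤ Ab where
  obj U := AddCommGrpCat.of (DualSection M U.unop)
  map f := AddCommGrpCat.ofHom (DualSection.res f.unop.le)

instance (M : X.Modules) (U : X.Opensᵒᵖ) :
    Module (X.ringCatSheaf.obj.obj U) ((dualAbPresheaf M).obj U) :=
  inferInstanceAs (Module Γ(X, U.unop) (DualSection M U.unop))

/-- The presheaf of modules `U ↦ Hom(M|_U, 𝒪_U)`. -/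
def dualPresheaf (M : X.Modules) : X.PresheafOfModules :=
  PresheafOfModules.ofPresheaf (dualAbPresheaf M) (fun U V f r φ => by
    refine DualSection.ext' fun W hW => ?_
    change X.presheaf.map (homOfLE (hW.trans f.unop.le)).op r • _ =
      X.presheaf.map (homOfLE hW).op (X.presheaf.map f r) • _
    exact congrArg (· • φ.app W (hW.trans f.unop.le)) (map_map hW f.unop.le r).symm)

/-- Two sections of `𝒪_X` over `V ⊆ ⋃ U_i` that agree on all `V ∩ U_i` are equal. -/
lemma section_ext {ι : Type} {U : ι → X.Opens} {V : X.Opens} (hV : V ≤ iSup U) {a b : Γ(X, V)}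
    (h : ∀ i, X.presheaf.map (homOfLE (inf_le_left : V ⊓ U i ≤ V)).op a =
      X.presheaf.map (homOfLE (inf_le_left : V ⊓ U i ≤ V)).op b) : a = b :=
  X.sheaf.eq_of_locally_eq' (fun i => V ⊓ U i) V (fun _ => homOfLE inf_le_left)
    (by rw [← inf_iSup_eq]; exact le_inf le_rfl hV) a b h

lemma dualAbPresheaf_isSheaf (M : X.Modules) :
    TopCat.Presheaf.IsSheaf (X := X.toTopCat) (dualAbPresheaf M) := by
  rw [TopCat.Presheaf.isSheaf_iff_isSheafUniqueGluing]
  intro ι U sf hsf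
  change ∀ i, DualSection M (U i) at sf
  have compat : ∀ (i j : ι) (W : X.Opens) (hi : W ≤ U i) (hj : W ≤ U j) (m : Γ(M, W)),
      (sf i).app W hi m = (sf j).app W hj m := by
    intro i j W hi hj m
    have h : DualSection.res inf_le_left (sf i) = DualSection.res inf_le_right (sf j) := hsf i j
    exact congrArg (fun φ : DualSection M (U i ⊓ U j) => φ.app W (le_inf hi hj) m) h
  have key : ∀ (V : X.Opens) (_ : V ≤ iSup U) (m : Γ(M, V)), ∃ a : Γ(X, V), ∀ i,
      X.presheaf.map (homOfLE (inf_le_left : V ⊓ U i ≤ V)).op a =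
        (sf i).app (V ⊓ U i) inf_le_right (M.presheaf.map (homOfLE inf_le_left).op m) := by
    intro V hV m
    obtain ⟨a, ha, -⟩ := X.sheaf.existsUnique_gluing' (fun i => V ⊓ U i) V
      (fun _ => homOfLE inf_le_left) (by rw [← inf_iSup_eq]; exact le_inf le_rfl hV)
      (fun i => (sf i).app (V ⊓ U i) inf_le_right (M.presheaf.map (homOfLE inf_le_left).op m))
      (by
        intro i j
        have h1 := (sf i).naturality (V ⊓ U i) ((V ⊓ U i) ⊓ (V ⊓ U j)) inf_le_right inf_le_left
          (M.presheaf.map (homOfLE inf_le_left).op m)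
        have h2 := (sf j).naturality (V ⊓ U j) ((V ⊓ U i) ⊓ (V ⊓ U j)) inf_le_right inf_le_right
          (M.presheaf.map (homOfLE inf_le_left).op m)
        refine h1.symm.trans (Eq.trans ?_ h2)
        rw [modules_map_map, modules_map_map]
        exact compat _ _ _ _ _ _)
    exact ⟨a, ha⟩
  choose g hg using key
  have loc : ∀ (V : X.Opens) (hV : V ≤ iSup U) (m : Γ(M, V)) (i : ι) (W : X.Opens) (hW : W ≤ V)
      (hi : W ≤ U i), X.presheaf.map (homOfLE hW).op (g V hV m) =
        (sf i).app W hi (M.presheaf.map (homOfLE hW).op m) := by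
    intro V hV m i W hW hi
    have h := congrArg (X.presheaf.map (homOfLE (le_inf hW hi)).op) (hg V hV m i)
    rw [map_map, ← (sf i).naturality, modules_map_map] at h
    exact h
  refine ⟨(⟨fun V hV => { toFun := g V hV, map_add' := ?_, map_smul' := ?_ }, ?_⟩ :
    DualSection M (iSup U)), ?_, ?_⟩
  · intro m n
    refine section_ext hV fun i => ?_
    simp [hg]
  · intro r m
    refine section_ext hV fun i => ?_
    simp [hg]
  · intro V W hV hW m
    refine section_ext (hW.trans hV) fun i => ?_
    change X.presheaf.map _ (g W _ _) = X.presheaf.map _ (X.presheaf.map _ (g V _ _))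
    rw [map_map, loc _ _ _ i _ _ inf_le_right, loc _ _ _ i _ _ inf_le_right, modules_map_map]
  · intro i
    refine DualSection.ext' fun V hV => LinearMap.ext fun m => ?_
    change g V (hV.trans (le_iSup U i)) m = (sf i).app V hV m
    have h := loc V (hV.trans (le_iSup U i)) m i V le_rfl hV
    have e : (homOfLE (le_refl V)).op = 𝟙 (op V) := rfl
    rw [e, CategoryTheory.Functor.map_id, CategoryTheory.Functor.map_id] at h
    exact h
  · intro φ hφ
    change DualSection M (iSup U) at φ
    refine DualSection.ext' fun V hV => LinearMap.ext fun m => ?_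
    change φ.app V hV m = g V hV m
    refine section_ext hV fun i => ?_
    have h : DualSection.res (le_iSup U i) φ = sf i := hφ i
    rw [loc V hV m i _ _ inf_le_right, ← φ.naturality, ← h]
    rfl

/-- The dual `M^* = ℋom(M, 𝒪_X)` of an `𝒪_X`-module. -/
def dual (M : X.Modules) : X.Modules := ⟨dualPresheaf M, dualAbPresheaf_isSheaf M⟩

/-! ### Tensor products -/

/-- The tensor product of two `𝒪_X`-modules: the sheaf associated with `U ↦ M(U) ⊗ N(U)`. -/
def tensor (M N : X.Modules) : X.Modules :=
  (PresheafOfModules.sheafification (𝟙 X.ringCatSheaf.obj)).obj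
    (PresheafOfModules.Monoidal.tensorObj (R := X.presheaf) M.val N.val)

/-! ### Contractions -/

/-- Contraction with a global section `s` of `M`: the morphism `M^* ⟶ 𝒪_X`, `φ ↦ φ(s)`. -/
def contract (M : X.Modules) (s : Γ(M, ⊤)) : dual M ⟶ structureSheaf X :=
  ⟨PresheafOfModules.homMk
    { app U := AddCommGrpCat.ofHom
        { toFun := fun φ : DualSection M U.unop =>
            (φ.app U.unop le_rfl (M.presheaf.map (homOfLE le_top).op s) : Γ(X, U.unop))
          map_zero' := rfl
          map_add' := fun _ _ => rfl }
      naturality := fun U V f => by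
        refine AddCommGrpCat.hom_ext (AddMonoidHom.ext fun φ => ?_)
        change DualSection M U.unop at φ
        change φ.app V.unop f.unop.le (M.presheaf.map (homOfLE le_top).op s) =
          X.presheaf.map f (φ.app U.unop le_rfl (M.presheaf.map (homOfLE le_top).op s))
        have h := φ.naturality U.unop V.unop le_rfl f.unop.le
          (M.presheaf.map (homOfLE le_top).op s)
        rw [modules_map_map] at h
        exact h }
    (fun U r φ => by
      change DualSection M U.unop at φ
      change Γ(X, U.unop) at r
      change (X.presheaf.map (𝟙 U) r : Γ(X, U.unop)) • φ.app U.unop le_rfl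
          (M.presheaf.map (homOfLE le_top).op s) =
        r • φ.app U.unop le_rfl (M.presheaf.map (homOfLE le_top).op s)
      rw [CategoryTheory.Functor.map_id]
      rfl)⟩

/-- The presheaf morphism underlying `contractRight`: `m ⊗ φ ↦ φ(s) m`. -/
def contractRightPresheaf (M N : X.Modules) (s : Γ(N, ⊤)) :
    PresheafOfModules.Monoidal.tensorObj (R := X.presheaf) M.val (dual N).val ⟶ M.val :=
  PresheafOfModules.Monoidal.tensorHom (R := X.presheaf) (𝟙 M.val) (contract N s).val ≫
    (rightUnitor (C := _root_.PresheafOfModules (X.presheaf ⋙ forget₂ CommRingCat RingCat)) M.val).hom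

/-- Contraction of the second factor with a global section `s` of `N`:
the morphism `M ⊗ N^* ⟶ M`, `m ⊗ φ ↦ φ(s) m`. -/
def contractRight (M N : X.Modules) (s : Γ(N, ⊤)) : tensor M (dual N) ⟶ M :=
  ((PresheafOfModules.sheafificationAdjunction (𝟙 X.ringCatSheaf.obj)).homEquiv _ _).symm
    (contractRightPresheaf M N s)

/-! ### Vector bundles and global generation -/

/-- `E` is a vector bundle of rank `r`: it is locally isomorphic to `𝒪^r`. -/
def IsVectorBundle (E : X.Modules) (r : ℕ) : Prop :=
  ∀ x : X, ∃ U : X.Opens, x ∈ U ∧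
    Nonempty (E.restrict U.ι ≅ SheafOfModules.free (R := (U : Scheme.{0}).ringCatSheaf) (Fin r))

/-- `E` is globally generated: some family of global sections defines an epimorphism from a free
`𝒪_X`-module onto `E`. -/
def IsGloballyGenerated (E : X.Modules) : Prop :=
  Nonempty (SheafOfModules.GeneratingSections E)

/-! ### Schemes over `ℂ`: global sections and the canonical sheaf -/

variable {C : Scheme.{0}} (f : C ⟶ Spec (.of ℂ))

/-- The structure map `ℂ → 𝒪_C(U)` of a scheme `C` over `ℂ`. -/
def scalars (U : C.Opens) : CommRingCat.of ℂ ⟶ Γ(C, U) :=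
  (Scheme.ΓSpecIso (.of ℂ)).inv ≫ f.appTop ≫ C.presheaf.map (homOfLE le_top).op

/-- The space `H^0(C, M)` of global sections of a sheaf of modules on a scheme `C` over `ℂ`. -/
def H0 (_ : C ⟶ Spec (.of ℂ)) (M : C.Modules) : Type := Γ(M, ⊤)

instance (M : C.Modules) : AddCommGroup (H0 f M) := inferInstanceAs (AddCommGroup Γ(M, ⊤))

instance (M : C.Modules) : Module ℂ (H0 f M) :=
  Module.compHom (R := Γ(C, ⊤)) Γ(M, ⊤) (scalars f ⊤).hom

/-- The structure maps `ℂ → 𝒪_C(U)`, as a morphism from the constant presheaf `ℂ` to `𝒪_C`. -/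
def scalarsHom : (Functor.const C.Opensᵒᵖ).obj (CommRingCat.of ℂ) ⟶ C.presheaf where
  app U := scalars f U.unop
  naturality U V i := by
    change 𝟙 _ ≫ scalars f V.unop = scalars f U.unop ≫ C.presheaf.map i
    rw [scalars, scalars, Category.id_comp, Category.assoc, Category.assoc, ← Functor.map_comp]
    rfl

/-- The sheaf of Kähler differentials `Ω_{C/ℂ}`, associated with `U ↦ Ω_{𝒪_C(U)/ℂ}`.
For a smooth curve this is the canonical bundle `K_C`. -/
def canonicalSheaf : C.Modules :=
  (PresheafOfModules.sheafification (𝟙 C.ringCatSheaf.obj)).obj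
    (PresheafOfModules.DifferentialsConstruction.relativeDifferentials' (scalarsHom f))

/-- The tangent sheaf `T_C`, the dual of `K_C`. -/
def tangentSheaf : C.Modules := dual (canonicalSheaf f)

/-! ### The matrix of linear forms and its restriction to the curve -/

/-- The Petri trace map `μ̄ : H^0(C, E) ⊗ H^0(C, K_C ⊗ E^*) → H^0(C, K_C)` on pure tensors
`s ⊗ t`: multiply and take the trace, that is, contract the factor `E^*` of `t` with `s`. -/
def petriTrace (E : C.Modules) (s : H0 f E) (t : H0 f (tensor (canonicalSheaf f) (dual E))) :
    H0 f (canonicalSheaf f) :=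
  (contractRight (canonicalSheaf f) E s).app ⊤ t

/-- The matrix `Λ = (l_ij)`, `l_ij = μ̄(s_i ⊗ t_j)`, of linear forms on `|K_C|^* = ℙ(H^0(K_C)^*)`:
such linear forms are the elements of `H^0(C, K_C)`. -/
def linearFormMatrix {ι κ : Type} (E : C.Modules) (s : ι → H0 f E)
    (t : κ → H0 f (tensor (canonicalSheaf f) (dual E))) :
    Matrix ι κ (H0 f (canonicalSheaf f)) :=
  Matrix.of fun i j => petriTrace f E (s i) (t j)

instance (X : Scheme.{0}) : HasFiniteBiproducts X.Modules := Abelian.hasFiniteBiproducts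

/-- The restriction to `C` of a matrix `A` of linear forms on `|K_C|^*`, as a morphism from the sum
of copies of `T_C` indexed by the rows to the sum of copies of `𝒪_C` indexed by the columns.
The canonical map sends `p` to the line `T_C|_p → H^0(K_C)^*`, so that `𝒪(-1)` pulls back to `T_C`,
and a linear form `l ∈ H^0(K_C)` pulls back to the contraction `T_C ⟶ 𝒪_C` with `l`. -/
def restrictToCurve {ι κ : Type} [Finite ι] [Finite κ]
    (A : Matrix ι κ (H0 f (canonicalSheaf f))) :
    (⨁ fun _ : ι => tangentSheaf f) ⟶ (⨁ fun _ : κ => structureSheaf C) :=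
  biproduct.matrix fun i j => contract (canonicalSheaf f) (A i j)

end CurveBundles
end

/-! Write `K` and `T` for the canonical and tangent sheaves. Evaluating `φ` in `E^*` on the sections
`s_i` gives `evalSections : E^* ⟶ 𝒪^(r+1)`. It is mono because the `s_i` generate `E`. The map
`Λ^t|_C` sends `v` in the `j`-th copy of `T` to `(v(μ̄(s_i ⊗ t_j)))_i`, so it is the composite `T ⊗
H^0(K ⊗ E^*) → T ⊗ K ⊗ E^* → E^* → 𝒪^(r+1)`. The first arrow is onto because `K ⊗ E^*` is globally
generated, the second because `T` and `K` pair onto `𝒪`, and the last is mono. Hence the image is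
`E^*`.

The middle arrow is never built globally. Locally, pairing `v` with `t_j` gives a section of `E^*`
(`exists_pairing`), so `Λ^t|_C` dies in the cokernel of `evalSections`
(`restrictToCurve_comp_cokernel`) and lifts through that mono. The lift is locally onto by
`exists_restrictToCurve_eq`: if `v(k) = 1`, expand `k ⊗ ψ` in the `t_j` and pair with `v` to recover
`ψ`.

Smoothness enters only through the local existence of `k`, `v` with `v(k) = 1`
(`exists_canonicalSheaf_pairing_eq_one`). On a small affine `W`, the differentials of `Γ(C, W)` are
free of rank one. A coordinate functional composed with `d` is a derivation of `Γ(C, W)`. It extends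
to the structure sheaf of `W`, and the universal property of differentials turns it into a section
of `T` over `W`. -/

noncomputable section

namespace CurveBundles

/-! ### Associated sheaves and epimorphisms, tested locally. -/

section

variable {X : Scheme.{0}}

lemma hom_map {M N : X.Modules} (φ : M ⟶ N) {U V : X.Opens} (h : V ≤ U) (m : Γ(M, U)) :
    φ.app V (M.presheaf.map (homOfLE h).op m) = N.presheaf.map (homOfLE h).op (φ.app U m) :=
  NatTrans.naturality_apply φ.mapPresheaf (homOfLE h).op m

/-- A section of an `𝒪_X`-module that vanishes locally is zero. -/
lemma eq_of_locally_eq {M : X.Modules} {U : X.Opens} {a b : Γ(M, U)}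
    (h : ∀ x ∈ U, ∃ (V : X.Opens) (hV : V ≤ U), x ∈ V ∧
      M.presheaf.map (homOfLE hV).op a = M.presheaf.map (homOfLE hV).op b) : a = b := by
  choose V hV hx e using h
  refine TopCat.Sheaf.eq_of_locally_eq' ⟨M.presheaf, M.isSheaf⟩
    (fun i : U => V i.1 i.2) U (fun i => homOfLE (hV i.1 i.2)) ?_ a b (fun i => e i.1 i.2)
  intro x hxU
  exact Opens.mem_iSup.2 ⟨⟨x, hxU⟩, hx x hxU⟩

/-- The sheaf associated with a presheaf of modules. -/
abbrev associatedSheaf (P : X.PresheafOfModules) : X.Modules :=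
  (PresheafOfModules.sheafification (𝟙 X.ringCatSheaf.obj)).obj P

/-- The unit of sheafification, on sections. -/
def toSheafification (P : X.PresheafOfModules) (U : X.Opens) :
    P.obj (op U) → Γ(associatedSheaf P, U) :=
  fun p => (CategoryTheory.toSheafify (Opens.grothendieckTopology X) P.presheaf).app (op U) p

lemma exists_toSheafification_eq (P : X.PresheafOfModules) (U : X.Opens)
    (m : Γ(associatedSheaf P, U)) (x : X) (hx : x ∈ U) :
    ∃ (V : X.Opens) (hV : V ≤ U) (p : P.obj (op V)), x ∈ V ∧ toSheafification P V p =
      (associatedSheaf P).presheaf.map (homOfLE hV).op m := by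
  obtain ⟨V, i, ⟨p, hp⟩, hxV⟩ := (inferInstance : Presheaf.IsLocallySurjective
    (Opens.grothendieckTopology X)
    (CategoryTheory.toSheafify (Opens.grothendieckTopology X) P.presheaf)).imageSieve_mem m x hx
  exact ⟨V, i.le, p, hxV, hp⟩

lemma exists_map_eq_zero_of_toSheafification_eq_zero (P : X.PresheafOfModules) (U : X.Opens)
    (p : P.obj (op U)) (hp : toSheafification P U p = toSheafification P U 0)
    (x : X) (hx : x ∈ U) :
    ∃ (V : X.Opens) (hV : V ≤ U), x ∈ V ∧ P.map (homOfLE hV).op p = 0 := by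
  obtain ⟨V, i, e, hxV⟩ := (inferInstance : Presheaf.IsLocallyInjective
    (Opens.grothendieckTopology X)
    (CategoryTheory.toSheafify (Opens.grothendieckTopology X) P.presheaf)).equalizerSieve_mem
      (X := op U) p 0 hp x hx
  exact ⟨V, i.le, hxV, Eq.trans e (map_zero (P.presheaf.map i.op).hom)⟩

/-- Epimorphisms of `𝒪_X`-modules are locally surjective. -/
lemma exists_app_eq_of_epi {M N : X.Modules} (φ : M ⟶ N) [Epi φ] (U : X.Opens) (n : Γ(N, U))
    (x : X) (hx : x ∈ U) :
    ∃ (V : X.Opens) (hV : V ≤ U) (m : Γ(M, V)), x ∈ V ∧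
      φ.app V m = N.presheaf.map (homOfLE hV).op n := by
  -- The cokernel is taken among presheaves and then sheafified. Since `φ` is epi, `N` maps to zero
  -- there, so the class of `n` vanishes on a smaller open set, where exactness of the presheaf
  -- cokernel gives a preimage.
  let Q := cokernel φ.val
  let g : N ⟶ associatedSheaf Q :=
    ⟨cokernel.π φ.val ≫ (PresheafOfModules.sheafificationAdjunction
      (𝟙 X.ringCatSheaf.obj)).unit.app Q⟩
  have hg : g = 0 := by
    rw [← cancel_epi φ, comp_zero]
    refine SheafOfModules.hom_ext ?_
    exact (Category.assoc φ.val (cokernel.π φ.val) _).symm.trans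
      ((congrArg (· ≫ (PresheafOfModules.sheafificationAdjunction
        (𝟙 X.ringCatSheaf.obj)).unit.app Q) (cokernel.condition φ.val)).trans zero_comp)
  have h0 : toSheafification Q U ((cokernel.π φ.val).app (op U) n) = toSheafification Q U 0 := by
    refine Eq.trans (congrArg (fun ψ => Scheme.Modules.Hom.app ψ U n) hg) ?_
    exact (map_zero ((CategoryTheory.toSheafify (Opens.grothendieckTopology X)
      Q.presheaf).app (op U)).hom).symm
  obtain ⟨V, hV, hxV, e⟩ := exists_map_eq_zero_of_toSheafification_eq_zero Q U _ h0 x hx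
  have hex := ((ShortComplex.exact_cokernel φ.val).map
    (PresheafOfModules.evaluation _ (op V)))
  rw [ShortComplex.moduleCat_exact_iff] at hex
  obtain ⟨m, hm⟩ := hex (N.presheaf.map (homOfLE hV).op n) (Eq.trans (PresheafOfModules.naturality_apply (cokernel.π φ.val) (homOfLE hV).op n) e)
  exact ⟨V, hV, m, hxV, hm⟩

/-- Locally surjective morphisms of `𝒪_X`-modules are epimorphisms. -/
lemma epi_of_exists_app_eq {M N : X.Modules} (φ : M ⟶ N)
    (h : ∀ (U : X.Opens) (n : Γ(N, U)) (x : X), x ∈ U →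
      ∃ (V : X.Opens) (hV : V ≤ U) (m : Γ(M, V)), x ∈ V ∧
        φ.app V m = N.presheaf.map (homOfLE hV).op n) : Epi φ := by
  refine Preadditive.epi_of_cancel_zero _ fun {Q} g hg => ?_
  ext U n
  refine eq_of_locally_eq fun x hx => ?_
  obtain ⟨V, hV, m, hxV, e⟩ := h U n x hx
  refine ⟨V, hV, hxV, ?_⟩
  rw [← hom_map, ← e]
  have := congrArg (fun ψ => Scheme.Modules.Hom.app ψ V m) hg
  simpa using this

end

/-! ### Pure tensors and local induction on tensor sections. -/

section

variable {X : Scheme.{0}}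

lemma toSheafification_add (P : X.PresheafOfModules) (U : X.Opens) (p q : P.obj (op U)) :
    toSheafification P U (p + q) = toSheafification P U p + toSheafification P U q :=
  map_add ((CategoryTheory.toSheafify (Opens.grothendieckTopology X) P.presheaf).app (op U)).hom p q

lemma toSheafification_zero (P : X.PresheafOfModules) (U : X.Opens) :
    toSheafification P U 0 = 0 :=
  map_zero ((CategoryTheory.toSheafify (Opens.grothendieckTopology X) P.presheaf).app (op U)).hom

lemma toSheafification_map (P : X.PresheafOfModules) {U V : X.Opens} (h : V ≤ U)
    (p : P.obj (op U)) :
    toSheafification P V (P.map (homOfLE h).op p) =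
      (associatedSheaf P).presheaf.map (homOfLE h).op (toSheafification P U p) :=
  NatTrans.naturality_apply (CategoryTheory.toSheafify (Opens.grothendieckTopology X) P.presheaf)
    (homOfLE h).op p

/-- The morphism out of an associated sheaf defined by a morphism of presheaves. -/
def associatedSheafDesc {P : X.PresheafOfModules} {F : X.Modules} (g : P ⟶ F.val) :
    associatedSheaf P ⟶ F :=
  ((PresheafOfModules.sheafificationAdjunction (𝟙 X.ringCatSheaf.obj)).homEquiv P F).symm g

lemma associatedSheafDesc_app {P : X.PresheafOfModules} {F : X.Modules} (g : P ⟶ F.val)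
    (U : X.Opens) (p : P.obj (op U)) :
    (associatedSheafDesc g).app U (toSheafification P U p) = g.app (op U) p := by
  have h := ((PresheafOfModules.sheafificationAdjunction
    (𝟙 X.ringCatSheaf.obj)).homEquiv P F).apply_symm_apply g
  exact congrArg (fun k : P ⟶ F.val => k.app (op U) p) h

/-- The section `m ⊗ n` of `M ⊗ N`. -/
def tmul {M N : X.Modules} {U : X.Opens} (m : Γ(M, U)) (n : Γ(N, U)) : Γ(tensor M N, U) :=
  toSheafification (PresheafOfModules.Monoidal.tensorObj (R := X.presheaf) M.val N.val) U
    (TensorProduct.tmul (X.presheaf.obj (op U)) m n)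

lemma contractRight_app_tmul {M N : X.Modules} (s : Γ(N, ⊤)) {U : X.Opens} (m : Γ(M, U))
    (φ : DualSection N U) :
    (contractRight M N s).app U (tmul (N := dual N) m φ) =
      φ.app U le_rfl (N.presheaf.map (homOfLE le_top).op s) • m :=
  associatedSheafDesc_app (contractRightPresheaf M N s) U _

/-- Induction on sections of a tensor product: locally they are sums of pure tensors. -/
lemma tensor_induction {M N : X.Modules} (P : ∀ U : X.Opens, Γ(tensor M N, U) → Prop)
    (zero : ∀ U, P U 0) (add : ∀ U a b, P U a → P U b → P U (a + b))
    (tmul : ∀ U (m : Γ(M, U)) (n : Γ(N, U)), P U (tmul m n))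
    {U : X.Opens} (t : Γ(tensor M N, U)) (x : X) (hx : x ∈ U) :
    ∃ (V : X.Opens) (hV : V ≤ U), x ∈ V ∧
      P V ((tensor M N).presheaf.map (homOfLE hV).op t) := by
  obtain ⟨V, hV, p, hxV, e⟩ := exists_toSheafification_eq _ U t x hx
  refine ⟨V, hV, hxV, ?_⟩
  refine cast (congrArg (P V) e) ?_
  clear e
  refine TensorProduct.induction_on (motive := fun z : TensorProduct (X.presheaf.obj (op V))
    Γ(M, V) Γ(N, V) => P V (toSheafification _ V z)) p ?_ ?_ ?_
  · exact cast (congrArg (P V) (toSheafification_zero _ V).symm) (zero V)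
  · exact tmul V
  · intro a b ha hb
    have e : (toSheafification _ V (a + b) : Γ(tensor M N, V)) =
        (toSheafification _ V a : Γ(tensor M N, V)) + (toSheafification _ V b : Γ(tensor M N, V)) :=
      toSheafification_add (PresheafOfModules.Monoidal.tensorObj (R := X.presheaf) M.val N.val) V a b
    exact cast (congrArg (P V) e.symm) (add V _ _ ha hb)

end

/-! ### Global generation by a basis of global sections. -/

section

variable {X : Scheme.{0}}

lemma tmul_map {M N : X.Modules} {U V : X.Opens} (h : V ≤ U) (m : Γ(M, U)) (n : Γ(N, U)) :
    (tensor M N).presheaf.map (homOfLE h).op (tmul m n) =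
      tmul (M.presheaf.map (homOfLE h).op m) (N.presheaf.map (homOfLE h).op n) :=
  (toSheafification_map (PresheafOfModules.Monoidal.tensorObj (R := X.presheaf) M.val N.val) h
    (TensorProduct.tmul (X.presheaf.obj (op U)) m n)).symm

/-- A morphism out of a globally generated module that kills the global sections is zero. -/
lemma IsGloballyGenerated.eq_zero {M N : X.Modules} (hM : IsGloballyGenerated M) (g : M ⟶ N)
    (hg : ∀ m : Γ(M, ⊤), g.app ⊤ m = 0) : g = 0 := by
  obtain ⟨σ⟩ := hM
  have := σ.epi
  refine this.left_cancellation g (0 : M ⟶ N) ?_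
  refine (SheafOfModules.freeHomEquiv_symm_comp (R := X.ringCatSheaf) σ.s g).trans
    (Eq.trans ?_ (SheafOfModules.freeHomEquiv_symm_comp (R := X.ringCatSheaf) (N := N)
      σ.s (0 : M ⟶ N)).symm)
  congr 1
  funext i
  refine Subtype.ext (funext fun U => ?_)
  change g.app U.unop ((σ.s i).1 U) = 0
  have h : (σ.s i).1 U = M.presheaf.map (homOfLE (le_top : U.unop ≤ ⊤)).op ((σ.s i).1 (op ⊤)) :=
    ((σ.s i).2 (homOfLE (le_top : U.unop ≤ ⊤)).op).symm
  rw [h]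
  exact (hom_map g le_top _).trans ((congrArg _ (hg _)).trans (map_zero _))

/-- The morphism `𝒪_X ⟶ M` given by a global section. -/
def ofSection {M : X.Modules} (m : Γ(M, ⊤)) : structureSheaf X ⟶ M :=
  ⟨PresheafOfModules.homMk
    { app U := AddCommGrpCat.ofHom
        ((smulAddHom Γ(X, U.unop) Γ(M, U.unop)).flip (M.presheaf.map (homOfLE le_top).op m))
      naturality := fun U V f => by
        refine AddCommGrpCat.hom_ext (AddMonoidHom.ext fun a => ?_)
        change Γ(X, U.unop) at a
        change (X.presheaf.map (homOfLE f.unop.le).op a : Γ(X, V.unop)) •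
            M.presheaf.map (homOfLE le_top).op m =
          M.presheaf.map (homOfLE f.unop.le).op (a • M.presheaf.map (homOfLE le_top).op m)
        rw [Scheme.Modules.map_smul, modules_map_map] }
    (fun U r a => mul_smul (α := Γ(X, U.unop)) (β := Γ(M, U.unop)) r a _)⟩

lemma sum_app {ι : Type} (I : Finset ι) {M N : X.Modules} (g : ι → (M ⟶ N)) (U : X.Opens)
    (y : Γ(M, U)) : (∑ i ∈ I, g i).app U y = ∑ i ∈ I, (g i).app U y := by
  classical
  induction I using Finset.induction_on with
  | empty => rfl
  | insert i I hi ih => rw [Finset.sum_insert hi, Finset.sum_insert hi, ← ih]; rfl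

lemma sum_ι_app_π_app {ι : Type} [Fintype ι] (F : ι → X.Modules) (U : X.Opens)
    (y : Γ(⨁ F, U)) :
    ∑ i, (biproduct.ι F i).app U ((biproduct.π F i).app U y) = y := by
  have h := congrArg (fun g : ⨁ F ⟶ ⨁ F => g.app U y) (biproduct.total (f := F))
  exact (sum_app Finset.univ (fun i => biproduct.π F i ≫ biproduct.ι F i) U y).symm.trans h

lemma biproduct_section_ext {ι : Type} [Finite ι] (F : ι → X.Modules) (U : X.Opens)
    {y z : Γ(⨁ F, U)} (h : ∀ i, (biproduct.π F i).app U y = (biproduct.π F i).app U z) :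
    y = z := by
  have := Fintype.ofFinite ι
  rw [← sum_ι_app_π_app F U y, ← sum_ι_app_π_app F U z]
  simp only [h]

variable {C : Scheme.{0}} (f : C ⟶ Spec (.of ℂ))

/-- The basis alone already gives an epimorphism `𝒪^n ⟶ M`. A morphism out of `M` that kills the
basis kills every global section by `ℂ`-linearity, hence is zero. Epimorphisms are locally
surjective, and the coordinates of a local preimage are the coefficients. -/
lemma exists_sum_smul_basis {M : C.Modules} (hM : IsGloballyGenerated M) {n : ℕ}
    (t : Module.Basis (Fin n) ℂ (H0 f M)) {U : C.Opens} (m : Γ(M, U)) (x : C) (hx : x ∈ U) :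
    ∃ (V : C.Opens) (hV : V ≤ U) (a : Fin n → Γ(C, V)), x ∈ V ∧
      M.presheaf.map (homOfLE hV).op m =
        ∑ j, a j • M.presheaf.map (homOfLE le_top).op (t j : Γ(M, ⊤)) := by
  let p : (⨁ fun _ : Fin n => structureSheaf C) ⟶ M := biproduct.desc fun j => ofSection (t j)
  have : Epi p := by
    refine Preadditive.epi_of_cancel_zero _ fun {Q} g hg => hM.eq_zero g fun m => ?_
    have ht : ∀ j, g.app ⊤ (t j : Γ(M, ⊤)) = 0 := by
      intro j
      have h1 : ofSection (t j : Γ(M, ⊤)) ≫ g = 0 := by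
        rw [← biproduct.ι_desc (fun j => ofSection (t j : Γ(M, ⊤))) j, Category.assoc]
        exact (congrArg (biproduct.ι (fun _ : Fin n => structureSheaf C) j ≫ ·) hg).trans comp_zero
      have h2 := congrArg (fun ψ : structureSheaf C ⟶ Q => ψ.app ⊤ (1 : Γ(C, ⊤))) h1
      have h3 : g.app ⊤ ((1 : Γ(C, ⊤)) • M.presheaf.map (homOfLE le_top).op (t j : Γ(M, ⊤))) = 0 := h2
      rw [one_smul] at h3
      have e : (homOfLE (le_top : (⊤ : C.Opens) ≤ ⊤)).op = 𝟙 (op ⊤) := rfl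
      rw [e, CategoryTheory.Functor.map_id] at h3
      exact h3
    let G : H0 f M →ₗ[ℂ] H0 f Q :=
      { toFun := fun m => g.app ⊤ m
        map_add' := fun a b => map_add (g.app ⊤).hom a b
        map_smul' := fun c a => Scheme.Modules.Hom.app_smul g (scalars f ⊤ c) a }
    have hG : G = 0 := t.ext ht
    exact congrArg (fun l : H0 f M →ₗ[ℂ] H0 f Q => l m) hG
  obtain ⟨V, hV, y, hxV, e⟩ := exists_app_eq_of_epi p U m x hx
  refine ⟨V, hV, fun j => (biproduct.π (fun _ : Fin n => structureSheaf C) j).app V y, hxV, ?_⟩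
  rw [← e, ← sum_ι_app_π_app _ V y, map_sum]
  refine Finset.sum_congr rfl fun j _ => ?_
  rw [sum_ι_app_π_app]
  have h : biproduct.ι (fun _ : Fin n => structureSheaf C) j ≫ p = ofSection (t j : Γ(M, ⊤)) :=
    biproduct.ι_desc _ _
  exact congrArg (fun g : structureSheaf C ⟶ M => g.app V
    ((biproduct.π (fun _ : Fin n => structureSheaf C) j).app V y)) h

/-- A section of the dual of `M` is determined by its values on a basis of the global sections if
`M` is globally generated. -/
lemma DualSection.ext_basis {M : C.Modules} (hM : IsGloballyGenerated M) {n : ℕ}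
    (t : Module.Basis (Fin n) ℂ (H0 f M)) {U : C.Opens} {φ ψ : DualSection M U}
    (h : ∀ j, φ.app U le_rfl (M.presheaf.map (homOfLE le_top).op (t j : Γ(M, ⊤))) =
      ψ.app U le_rfl (M.presheaf.map (homOfLE le_top).op (t j : Γ(M, ⊤)))) : φ = ψ := by
  refine DualSection.ext' fun V hV => LinearMap.ext fun m => ?_
  refine eq_of_locally_eq (M := structureSheaf C) fun x hx => ?_
  obtain ⟨W, hW, a, hxW, e⟩ := exists_sum_smul_basis f hM t m x hx
  refine ⟨W, hW, hxW, ?_⟩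
  have key : ∀ y : Γ(M, ⊤), φ.app U le_rfl (M.presheaf.map (homOfLE le_top).op y) =
      ψ.app U le_rfl (M.presheaf.map (homOfLE le_top).op y) →
      φ.app W (hW.trans hV) (M.presheaf.map (homOfLE le_top).op y) =
        ψ.app W (hW.trans hV) (M.presheaf.map (homOfLE le_top).op y) := by
    intro y hy
    have h1 := congrArg (C.presheaf.map (homOfLE (hW.trans hV)).op) hy
    rwa [← φ.naturality, ← ψ.naturality, modules_map_map] at h1
  refine (φ.naturality V W hV hW m).symm.trans (Eq.trans ?_ (ψ.naturality V W hV hW m))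
  rw [e, map_sum, map_sum]
  refine Finset.sum_congr rfl fun j _ => ?_
  rw [map_smul, map_smul]
  congr 1
  exact key _ (h j)

end

/-! ### Lifting `Λ^t|_C` to `E^*`. -/

section

variable {X : Scheme.{0}}

/-- Pairing a section `v` of `M^*` with a section `t` of `M ⊗ N^*` gives, locally, a section
of `N^*`. -/
lemma exists_pairing {M N : X.Modules} {U : X.Opens} (v : DualSection M U)
    (t : Γ(tensor M (dual N), U)) (x : X) (hx : x ∈ U) :
    ∃ (V : X.Opens) (hV : V ≤ U) (ψ : DualSection N V), x ∈ V ∧ ∀ s : Γ(N, ⊤),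
      ψ.app V le_rfl (N.presheaf.map (homOfLE le_top).op s) =
        X.presheaf.map (homOfLE hV).op (v.app U le_rfl ((contractRight M N s).app U t)) := by
  -- The property only involves values on global sections of `N`, which makes it additive in `z`.
  -- For a pure tensor `m ⊗ φ` the witness is `v(m) φ`.
  let P : ∀ V : X.Opens, Γ(tensor M (dual N), V) → Prop := fun V z =>
    ∀ hV : V ≤ U, ∃ ψ : DualSection N V, ∀ s : Γ(N, ⊤),
      ψ.app V le_rfl (N.presheaf.map (homOfLE le_top).op s) =
        v.app V hV ((contractRight M N s).app V z)
  have zero : ∀ V, P V 0 := fun V hV => ⟨0, fun s => by simp⟩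
  have add : ∀ V a b, P V a → P V b → P V (a + b) := by
    intro V a b ha hb hV
    obtain ⟨ψ, hψ⟩ := ha hV
    obtain ⟨χ, hχ⟩ := hb hV
    refine ⟨ψ + χ, fun s => ?_⟩
    rw [map_add, map_add, ← hψ, ← hχ]
    rfl
  have pure : ∀ V (m : Γ(M, V)) (φ : Γ(dual N, V)), P V (tmul m φ) := by
    intro V m φ hV
    change DualSection N V at φ
    refine ⟨v.app V hV m • φ, fun s => ?_⟩
    rw [contractRight_app_tmul, map_smul, DualSection.smul_app]
    have e : (homOfLE (le_refl V)).op = 𝟙 (op V) := rfl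
    rw [e, CategoryTheory.Functor.map_id]
    exact mul_comm _ _
  obtain ⟨V, hV, hxV, h⟩ := tensor_induction P zero add pure t x hx
  obtain ⟨ψ, hψ⟩ := h hV
  refine ⟨V, hV, ψ, hxV, fun s => (hψ s).trans ?_⟩
  rw [hom_map]
  exact v.naturality U V le_rfl hV _

variable {C : Scheme.{0}} (f : C ⟶ Spec (.of ℂ))

/-- Evaluation of sections of `E^*` on finitely many global sections of `E`. -/
def evalSections {E : C.Modules} {ι : Type} [Finite ι] (s : ι → H0 f E) :
    dual E ⟶ (⨁ fun _ : ι => structureSheaf C) :=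
  biproduct.lift fun i => contract E (s i)

lemma evalSections_π {E : C.Modules} {ι : Type} [Finite ι] (s : ι → H0 f E) (U : C.Opens)
    (φ : DualSection E U) (i : ι) :
    ((biproduct.π (fun _ : ι => structureSheaf C) i).app U ((evalSections f s).app U φ) :
      Γ(C, U)) = φ.app U le_rfl (E.presheaf.map (homOfLE le_top).op (s i : Γ(E, ⊤))) := by
  have h : evalSections f s ≫ biproduct.π _ i = contract E (s i) := biproduct.lift_π _ _
  exact congrArg (fun g : dual E ⟶ structureSheaf C => g.app U φ) h

lemma evalSections_app_injective {E : C.Modules} (hE : IsGloballyGenerated E) {n : ℕ}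
    (s : Module.Basis (Fin n) ℂ (H0 f E)) (U : C.Opens) :
    Function.Injective ((evalSections f s).app U) := by
  intro φ ψ h
  refine DualSection.ext_basis f hE s fun j => ?_
  refine (evalSections_π f s U φ j).symm.trans (Eq.trans ?_ (evalSections_π f s U ψ j))
  exact congrArg _ h

lemma mono_evalSections {E : C.Modules} (hE : IsGloballyGenerated E) {n : ℕ}
    (s : Module.Basis (Fin n) ℂ (H0 f E)) : Mono (evalSections f s) := by
  refine Preadditive.mono_of_cancel_zero _ fun {Q} g hg => ?_
  ext U q
  refine evalSections_app_injective f hE s U ?_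
  have h := congrArg (fun ψ => Scheme.Modules.Hom.app ψ U q) hg
  exact h.trans (map_zero ((evalSections f s).app U).hom).symm

lemma restrictToCurve_ι_π {ι κ : Type} [Finite ι] [Finite κ]
    (A : Matrix ι κ (H0 f (canonicalSheaf f))) (j : ι) (i : κ) (U : C.Opens)
    (v : DualSection (canonicalSheaf f) U) :
    ((biproduct.π (fun _ : κ => structureSheaf C) i).app U ((restrictToCurve f A).app U
      ((biproduct.ι (fun _ : ι => tangentSheaf f) j).app U v)) : Γ(C, U)) =
      v.app U le_rfl ((canonicalSheaf f).presheaf.map (homOfLE le_top).op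
        (A j i : Γ(canonicalSheaf f, ⊤))) := by
  have h : biproduct.ι (fun _ : ι => tangentSheaf f) j ≫ restrictToCurve f A ≫
      biproduct.π (fun _ : κ => structureSheaf C) i = contract (canonicalSheaf f) (A j i) := by
    exact (biproduct.ι_matrix_assoc (fun j i => contract (canonicalSheaf f) (A j i)) j _).trans
      (biproduct.lift_π _ _)
  exact congrArg (fun g : tangentSheaf f ⟶ structureSheaf C => g.app U v) h

/-- Vanishing can be tested locally on each copy of `T_C`. There the value of `Λ^t|_C` is
`evalSections` of the section of `E^*` obtained by pairing `v` with `t_j`, because both have `i`-th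
coordinate `v(μ̄(s_i ⊗ t_j))`. -/
lemma restrictToCurve_comp_cokernel {E : C.Modules} {n m : ℕ} (s : Fin n → H0 f E)
    (t : Fin m → H0 f (tensor (canonicalSheaf f) (dual E))) :
    restrictToCurve f (linearFormMatrix f E s t).transpose ≫
      cokernel.π (evalSections f s) = 0 := by
  refine biproduct.hom_ext' _ _ fun j => ?_
  ext U v
  change DualSection (canonicalSheaf f) U at v
  refine eq_of_locally_eq fun x hx => ?_
  obtain ⟨V, hV, ψ, hxV, hψ⟩ := exists_pairing v
    ((tensor (canonicalSheaf f) (dual E)).presheaf.map (homOfLE le_top).op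
      (t j : Γ(tensor (canonicalSheaf f) (dual E), ⊤))) x hx
  refine ⟨V, hV, hxV, ?_⟩
  have h : (⨁ fun _ : Fin n => structureSheaf C).presheaf.map (homOfLE hV).op
      ((restrictToCurve f (linearFormMatrix f E s t).transpose).app U
        ((biproduct.ι (fun _ : Fin m => tangentSheaf f) j).app U v)) =
      (evalSections f s).app V ψ := by
    refine biproduct_section_ext _ _ fun i => ?_
    refine Eq.trans ?_ (evalSections_π f s V ψ i).symm
    refine (hom_map (biproduct.π (fun _ : Fin n => structureSheaf C) i) hV _).trans ?_
    refine Eq.trans ?_ (hψ (s i)).symm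
    refine congrArg (C.presheaf.map (homOfLE hV).op) ?_
    refine (restrictToCurve_ι_π f (linearFormMatrix f E s t).transpose j i U v).trans ?_
    exact congrArg (v.app U le_rfl) (hom_map (contractRight (canonicalSheaf f) E (s i)) le_top
      (t j : Γ(tensor (canonicalSheaf f) (dual E), ⊤))).symm
  have h2 := congrArg (fun g : dual E ⟶ _ => g.app V ψ) (cokernel.condition (evalSections f s))
  rw [comp_zero]
  refine Eq.trans ?_ (map_zero _).symm
  refine Eq.trans ?_ h2
  refine Eq.trans ?_ (congrArg ((cokernel.π (evalSections f s)).app V) h)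
  rw [hom_map]
  rfl

end

/-! ### Local surjectivity onto `E^*` and the image. -/

section

variable {C : Scheme.{0}} (f : C ⟶ Spec (.of ℂ))

lemma tmul_pairing {M N : C.Modules} {V : C.Opens} (v : DualSection M V) (k : Γ(M, V))
    (hvk : v.app V le_rfl k = 1) (ψ : DualSection N V) (s : Γ(N, ⊤)) :
    v.app V le_rfl ((contractRight M N s).app V (tmul (N := dual N) k ψ)) =
      ψ.app V le_rfl (N.presheaf.map (homOfLE le_top).op s) := by
  rw [contractRight_app_tmul, map_smul, hvk]
  exact mul_one _

/-- Expand `k ⊗ ψ = ∑ a_j t_j` locally and put `a_j v` in the `j`-th copy of `T_C`. The `i`-th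
coordinate of the value is `v` applied to the contraction of `k ⊗ ψ` with `s_i`, that is `v(k)
ψ(s_i) = ψ(s_i)`. -/
lemma exists_restrictToCurve_eq {E : C.Modules} {n m : ℕ} (s : Fin n → H0 f E)
    (t : Module.Basis (Fin m) ℂ (H0 f (tensor (canonicalSheaf f) (dual E))))
    (hg : IsGloballyGenerated (tensor (canonicalSheaf f) (dual E)))
    {U : C.Opens} (k : Γ(canonicalSheaf f, U)) (v : DualSection (canonicalSheaf f) U)
    (hvk : v.app U le_rfl k = 1) (ψ : DualSection E U) (x : C) (hx : x ∈ U) :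
    ∃ (V : C.Opens) (hV : V ≤ U) (y : Γ(⨁ fun _ : Fin m => tangentSheaf f, V)), x ∈ V ∧
      (restrictToCurve f (linearFormMatrix f E s t).transpose).app V y =
        (evalSections f s).app V (DualSection.res hV ψ) := by
  obtain ⟨V, hV, a, hxV, e⟩ := exists_sum_smul_basis f hg t (tmul (N := dual E) k ψ) x hx
  refine ⟨V, hV, ∑ j, (biproduct.ι (fun _ : Fin m => tangentSheaf f) j).app V
    (a j • DualSection.res hV v : DualSection (canonicalSheaf f) V), hxV, ?_⟩
  refine biproduct_section_ext _ _ fun i => ?_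
  refine Eq.trans ?_ (evalSections_π f s V (DualSection.res hV ψ) i).symm
  rw [map_sum, map_sum]
  have hk : (DualSection.res hV v).app V le_rfl ((canonicalSheaf f).presheaf.map (homOfLE hV).op k)
      = 1 := by
    refine (v.naturality U V le_rfl hV k).trans ?_
    rw [hvk, map_one]
  replace e := (tmul_map (N := dual E) hV k ψ).symm.trans e
  refine Eq.trans ?_ (tmul_pairing (DualSection.res hV v) _ hk (DualSection.res hV ψ) (s i))
  refine Eq.trans ?_ (congrArg (fun z => (DualSection.res hV v).app V le_rfl
    ((contractRight (canonicalSheaf f) E (s i)).app V z)) e).symm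
  rw [map_sum, map_sum]
  refine Finset.sum_congr rfl fun j _ => ?_
  refine (restrictToCurve_ι_π f _ j i V _).trans ?_
  rw [Scheme.Modules.Hom.app_smul, map_smul, DualSection.smul_app]
  have e1 : (homOfLE (le_refl V)).op = 𝟙 (op V) := rfl
  rw [e1, CategoryTheory.Functor.map_id]
  refine congrArg (fun z : Γ(C, V) => a j * z) ?_
  exact congrArg ((DualSection.res hV v).app V le_rfl)
    (hom_map (contractRight (canonicalSheaf f) E (s i)) le_top
      (t j : Γ(tensor (canonicalSheaf f) (dual E), ⊤))).symm

/-- If the evaluation `T_C → 𝒪_C` against sections of `K_C` is locally onto, then the image of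
`Λ^t|_C` is `E^*`. -/
lemma nonempty_image_iso_dual
    (hf : ∀ x : C, ∃ (W : C.Opens) (k : Γ(canonicalSheaf f, W))
      (v : DualSection (canonicalSheaf f) W), x ∈ W ∧ v.app W le_rfl k = 1)
    {E : C.Modules} (hE : IsGloballyGenerated E)
    (hg : IsGloballyGenerated (tensor (canonicalSheaf f) (dual E))) {n m : ℕ}
    (s : Module.Basis (Fin n) ℂ (H0 f E))
    (t : Module.Basis (Fin m) ℂ (H0 f (tensor (canonicalSheaf f) (dual E)))) :
    Nonempty (image (restrictToCurve f (linearFormMatrix f E s t).transpose) ≅ dual E) := by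
  have := mono_evalSections f hE s
  let A := restrictToCurve f (linearFormMatrix f E s t).transpose
  let e := Abelian.monoLift (evalSections f s) A (restrictToCurve_comp_cokernel f s t)
  have he : e ≫ evalSections f s = A := Abelian.monoLift_comp _ _ _
  have : Epi e := by
    refine epi_of_exists_app_eq e fun U ψ x hx => ?_
    change DualSection E U at ψ
    obtain ⟨W, k, v, hxW, hvk⟩ := hf x
    obtain ⟨V, hV, y, hxV, hy⟩ := exists_restrictToCurve_eq f s t hg
      -- The pair `k`, `v` lives on `W` and `ψ` on `U`, so everything is restricted to the
      -- intersection. Injectivity of `evalSections` then turns equality in `𝒪^n` into equality in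
      -- `E^*`.
      (U := U ⊓ W) ((canonicalSheaf f).presheaf.map (homOfLE inf_le_right).op k)
      (DualSection.res inf_le_right v)
      ((v.naturality W (U ⊓ W) le_rfl inf_le_right k).trans (by rw [hvk, map_one]))
      (DualSection.res inf_le_left ψ) x ⟨hx, hxW⟩
    refine ⟨V, hV.trans inf_le_left, y, hxV, evalSections_app_injective f hE s V ?_⟩
    exact (congrArg (fun g : (⨁ fun _ : Fin m => tangentSheaf f) ⟶ (⨁ fun _ : Fin n => structureSheaf C) =>
      g.app V y) he).trans hy
  -- In an abelian category every epi is strong, so `A = e ≫ evalSections f s` is an image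
  -- factorization.
  have := strongEpi_of_epi e
  exact ⟨(image.isoStrongEpiMono e (evalSections f s) he).symm⟩

end

/-! ### Extending a derivation from an affine open set to its structure sheaf. -/

section

/-- A derivation extends to a localization. -/
lemma exists_derivation_localization {A B : Type} [CommRing A] [CommRing B] [Algebra A B]
    (M : Submonoid A) [IsLocalization M B] (d : Derivation ℤ A A) :
    ∃ D : Derivation ℤ B B, ∀ a, D (algebraMap A B a) = algebraMap A B (d a) := by
  -- Localizations are formally étale, so the differentials of `B` are the base change of those of
  -- `A`, and the functional attached to `d` extends by base change.
  have := Algebra.FormallyEtale.of_isLocalization (Rₘ := B) M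
  let l : Ω[A⁄ℤ] →ₗ[A] B := (Algebra.linearMap A B).comp d.liftKaehlerDifferential
  let L : Ω[B⁄ℤ] →ₗ[B] B := (l.liftBaseChange B).comp
    (KaehlerDifferential.tensorKaehlerEquivOfFormallyEtale ℤ A B).symm.toLinearMap
  refine ⟨L.compDer (KaehlerDifferential.D ℤ B), fun a => ?_⟩
  simp [L, l, KaehlerDifferential.tensorKaehlerEquivOfFormallyEtale_symm_D_algebraMap]

/-- A derivation on a localization is determined by its values on the ring. -/
lemma derivation_localization_unique {A B N : Type} [CommRing A] [CommRing B] [CommRing N]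
    [Algebra A B] (M : Submonoid A) [IsLocalization M B] (ρ : B →+* N) (δ ε : B → N)
    (hδ : ∀ a b, δ (a * b) = ρ a * δ b + ρ b * δ a)
    (hε : ∀ a b, ε (a * b) = ρ a * ε b + ρ b * ε a)
    (h : ∀ a, δ (algebraMap A B a) = ε (algebraMap A B a)) (b : B) : δ b = ε b := by
  -- From `b s = a`, the Leibniz rule determines `ρ(s) δ(b)`, and `ρ(s)` is a unit. Additivity plays
  -- no role.
  obtain ⟨⟨a, s⟩, hs⟩ := IsLocalization.surj M b
  have hu := (IsLocalization.map_units B s).map ρ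
  have h1 := h a
  rw [← hs, hδ, hε, h s] at h1
  exact hu.mul_right_cancel (by linear_combination h1)

variable {X : Scheme.{0}}

/-- Both sides satisfy the Leibniz rule along the restriction map and agree on `Γ(X, W)`, so
uniqueness on the localization applies. -/
lemma map_basicOpen_derivation {W : X.Opens} (hW : IsAffineOpen W)
    {d : Derivation ℤ Γ(X, W) Γ(X, W)} {g h : Γ(X, W)}
    {δ : Derivation ℤ Γ(X, X.basicOpen g) Γ(X, X.basicOpen g)}
    {ε : Derivation ℤ Γ(X, X.basicOpen h) Γ(X, X.basicOpen h)}
    (hδ : ∀ a, δ (X.presheaf.map (homOfLE (X.basicOpen_le g)).op a) =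
      X.presheaf.map (homOfLE (X.basicOpen_le g)).op (d a))
    (hε : ∀ a, ε (X.presheaf.map (homOfLE (X.basicOpen_le h)).op a) =
      X.presheaf.map (homOfLE (X.basicOpen_le h)).op (d a))
    (hgh : X.basicOpen h ≤ X.basicOpen g) (b : Γ(X, X.basicOpen g)) :
    X.presheaf.map (homOfLE hgh).op (δ b) = ε (X.presheaf.map (homOfLE hgh).op b) := by
  have := hW.isLocalization_basicOpen g
  refine derivation_localization_unique (Submonoid.powers g)
    (X.presheaf.map (homOfLE hgh).op).hom (fun b => X.presheaf.map (homOfLE hgh).op (δ b))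
    (fun b => ε (X.presheaf.map (homOfLE hgh).op b)) ?_ ?_ ?_ b
  · intro a b
    simp
  · intro a b
    simp
  · intro a
    change X.presheaf.map (homOfLE hgh).op (δ (X.presheaf.map (homOfLE (X.basicOpen_le g)).op a)) =
      ε (X.presheaf.map (homOfLE hgh).op (X.presheaf.map (homOfLE (X.basicOpen_le g)).op a))
    rw [hδ, map_map, map_map, hε]

lemma structureSheaf_eq_of_basicOpen {W : X.Opens} (hW : IsAffineOpen W) {V : X.Opens} (hV : V ≤ W)
    {a b : Γ(X, V)} (h : ∀ (g : Γ(X, W)) (hg : X.basicOpen g ≤ V),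
      X.presheaf.map (homOfLE hg).op a = X.presheaf.map (homOfLE hg).op b) : a = b := by
  refine eq_of_locally_eq (M := structureSheaf X) fun x hx => ?_
  obtain ⟨g, hg, hxg⟩ := hW.exists_basicOpen_le ⟨x, hx⟩ (hV hx)
  exact ⟨_, hg, hxg, h g hg⟩

/-- A derivation of the ring of functions on an affine open set `W` extends to the structure sheaf
of `W`. -/
lemma exists_derivation_extension {W : X.Opens} (hW : IsAffineOpen W)
    (d : Derivation ℤ Γ(X, W) Γ(X, W)) :
    ∃ D : ∀ V : X.Opens, V ≤ W → Derivation ℤ Γ(X, V) Γ(X, V),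
      (∀ (U V : X.Opens) (hU : U ≤ W) (hV : V ≤ U) (a : Γ(X, U)),
        D V (hV.trans hU) (X.presheaf.map (homOfLE hV).op a) =
          X.presheaf.map (homOfLE hV).op (D U hU a)) ∧ D W le_rfl = d := by
  have key : ∀ g : Γ(X, W), ∃ δ : Derivation ℤ Γ(X, X.basicOpen g) Γ(X, X.basicOpen g),
      ∀ a, δ (X.presheaf.map (homOfLE (X.basicOpen_le g)).op a) =
        X.presheaf.map (homOfLE (X.basicOpen_le g)).op (d a) := by
    intro g
    have := hW.isLocalization_basicOpen g
    exact exists_derivation_localization (Submonoid.powers g) d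
  choose δ hδ using key
  have glue : ∀ (V : X.Opens) (_ : V ≤ W) (a : Γ(X, V)), ∃ b : Γ(X, V),
      ∀ (g : Γ(X, W)) (hg : X.basicOpen g ≤ V), X.presheaf.map (homOfLE hg).op b =
        δ g (X.presheaf.map (homOfLE hg).op a) := by
    intro V hV a
    obtain ⟨b, hb, -⟩ := X.sheaf.existsUnique_gluing'
      (fun g : {g : Γ(X, W) // X.basicOpen g ≤ V} => X.basicOpen g.1) V (fun g => homOfLE g.2)
      (fun x hx => by
        obtain ⟨g, hg, hxg⟩ := hW.exists_basicOpen_le ⟨x, hx⟩ (hV hx)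
        exact Opens.mem_iSup.2 ⟨⟨g, hg⟩, hxg⟩)
      (fun g => δ g.1 (X.presheaf.map (homOfLE g.2).op a))
      (by
        rintro ⟨g, hg⟩ ⟨h, hh⟩
        refine eq_of_locally_eq (M := structureSheaf X) fun x hx => ?_
        -- The overlap is itself the basic open set of `g * h`, where both restrictions equal `δ (g
        -- * h)` of the restricted function.
        have hl : X.basicOpen (g * h) ≤ X.basicOpen g ⊓ X.basicOpen h := (X.basicOpen_mul g h).le
        refine ⟨X.basicOpen (g * h), hl, (X.basicOpen_mul g h).ge hx, ?_⟩
        have h1 := map_basicOpen_derivation hW (hδ g) (hδ (g * h)) (hl.trans inf_le_left)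
          (X.presheaf.map (homOfLE hg).op a)
        have h2 := map_basicOpen_derivation hW (hδ h) (hδ (g * h)) (hl.trans inf_le_right)
          (X.presheaf.map (homOfLE hh).op a)
        rw [map_map] at h1 h2
        exact (map_map hl inf_le_left _).trans (h1.trans (h2.symm.trans
          (map_map hl inf_le_right _).symm)))
    exact ⟨b, fun g hg => hb ⟨g, hg⟩⟩
  choose D hD using glue
  refine ⟨fun V hV => Derivation.mk' (AddMonoidHom.toIntLinearMap ⟨⟨D V hV, ?_⟩, ?_⟩) ?_, ?_, ?_⟩
  · refine structureSheaf_eq_of_basicOpen hW hV fun g hg => ?_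
    rw [hD, map_zero, map_zero]
  · intro a b
    refine structureSheaf_eq_of_basicOpen hW hV fun g hg => ?_
    simp [hD]
  · intro a b
    refine structureSheaf_eq_of_basicOpen hW hV fun g hg => ?_
    change X.presheaf.map (homOfLE hg).op (D V hV (a * b)) =
      X.presheaf.map (homOfLE hg).op (a * D V hV b + b * D V hV a)
    simp [hD]
  · intro U V hU hV a
    refine structureSheaf_eq_of_basicOpen hW (hV.trans hU) fun g hg => ?_
    change X.presheaf.map (homOfLE hg).op (D V _ _) =
      X.presheaf.map (homOfLE hg).op (X.presheaf.map (homOfLE hV).op (D U hU a))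
    rw [hD, map_map, map_map, hD]
  · ext a
    refine structureSheaf_eq_of_basicOpen hW le_rfl fun g hg => ?_
    exact (hD W le_rfl a g hg).trans (hδ g a)

end

/-! ### From derivations on `W` to sections of `T_C` over `W`. -/

section

variable {X : Scheme.{0}}

/-- The direct image on `X` of the structure sheaf of an open set `W`. -/
def directImage (W : X.Opens) : X.Modules :=
  (Scheme.Modules.pushforward W.ι).obj (Scheme.Modules.restrict (structureSheaf X) W.ι)

/-- The part of `V` that lies in `W`. -/
abbrev trace (W V : X.Opens) : X.Opens := W.ι ''ᵁ W.ι ⁻¹ᵁ V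

lemma trace_le_left (W V : X.Opens) : trace W V ≤ W := by
  rintro _ ⟨y, _, rfl⟩; exact y.2

lemma trace_le_right (W V : X.Opens) : trace W V ≤ V := W.ι.image_preimage_le V

lemma le_trace {W V : X.Opens} (h : V ≤ W) : V ≤ trace W V := fun x hx => ⟨⟨x, h hx⟩, hx, rfl⟩

/-- The scalar action on a pushforward of a restriction unwinds to multiplication by `r` restricted
to `W ∩ V`. -/
lemma directImage_smul (W V : X.Opens) (r : Γ(X, V)) (a : Γ(directImage W, V)) :
    r • a = (show Γ(directImage W, V) from
      (X.presheaf.map (homOfLE (trace_le_right W V)).op r * show Γ(X, trace W V) from a)) := by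
  have h := congrArg (fun k => k.hom r) (W.ι.app_appIso_inv V)
  exact congrArg (fun z : Γ(X, trace W V) => z * show Γ(X, trace W V) from a) h

variable {C : Scheme.{0}} (f : C ⟶ Spec (.of ℂ))

lemma map_scalars {U V : C.Opens} (h : V ≤ U) (c : ℂ) :
    C.presheaf.map (homOfLE h).op (scalars f U c) = scalars f V c := by
  rw [scalars, scalars]
  exact map_map h le_top _

/-- A derivation of the structure sheaf of `W`, as a derivation of `𝒪_C` into the direct image
of the structure sheaf of `W`. -/
def directImageDerivation {W : C.Opens}
    (D : ∀ V : C.Opens, V ≤ W → Derivation ℤ Γ(C, V) Γ(C, V))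
    (hD : ∀ (U V : C.Opens) (hU : U ≤ W) (hV : V ≤ U) (a : Γ(C, U)),
      D V (hV.trans hU) (C.presheaf.map (homOfLE hV).op a) =
        C.presheaf.map (homOfLE hV).op (D U hU a))
    (hc : ∀ c : ℂ, D W le_rfl (scalars f W c) = 0) :
    PresheafOfModules.Derivation' (directImage W).val (scalarsHom f) :=
  PresheafOfModules.Derivation'.mk
    (fun V => ModuleCat.Derivation.mk (f := scalars f V.unop)
      (fun a : Γ(C, V.unop) => (D (trace W V.unop) (trace_le_left _ _)
        (C.presheaf.map (homOfLE (trace_le_right W V.unop)).op a) : Γ(C, trace W V.unop)))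
      (fun a b => by
        change D _ _ (C.presheaf.map _ (a + b)) = (D _ _ _ + D _ _ _ : Γ(C, trace W V.unop))
        rw [map_add, map_add]
        rfl)
      (fun a b => by
        refine Eq.trans ?_ (congrArg₂ (fun x y : Γ(C, trace W V.unop) => x + y)
          (directImage_smul W V.unop a _) (directImage_smul W V.unop b _)).symm
        change D _ _ (C.presheaf.map _ (a * b)) = _
        rw [map_mul, Derivation.leibniz]
        rfl)
      (fun c => by
        change D _ _ (C.presheaf.map _ (scalars f V.unop c)) = 0
        rw [map_scalars, ← map_scalars f (trace_le_left W V.unop), hD W _ le_rfl, hc, map_zero]))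
    (fun U V i a => by
      change Γ(C, U.unop) at a
      change D _ _ (C.presheaf.map (homOfLE (trace_le_right W V.unop)).op
          (C.presheaf.map (homOfLE i.unop.le).op a)) =
        C.presheaf.map (homOfLE (Scheme.Hom.image_mono _ (W.ι.preimage_mono i.unop.le))).op
          (D (trace W U.unop) _ _)
      rw [← hD, map_map, map_map])

/-- The functional on `K_C|_W` defined by a derivation of the structure sheaf of `W`. -/
lemma exists_dualSection_of_derivation {W : C.Opens}
    (D : ∀ V : C.Opens, V ≤ W → Derivation ℤ Γ(C, V) Γ(C, V))
    (hD : ∀ (U V : C.Opens) (hU : U ≤ W) (hV : V ≤ U) (a : Γ(C, U)),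
      D V (hV.trans hU) (C.presheaf.map (homOfLE hV).op a) =
        C.presheaf.map (homOfLE hV).op (D U hU a))
    (hc : ∀ c : ℂ, D W le_rfl (scalars f W c) = 0) :
    ∃ v : DualSection (canonicalSheaf f) W,
      ∀ a : Γ(C, W), v.app W le_rfl (toSheafification
        (PresheafOfModules.DifferentialsConstruction.relativeDifferentials' (scalarsHom f)) W
        (CommRingCat.KaehlerDifferential.d (f := scalars f W) a)) = D W le_rfl a := by
  -- The universal property of differentials needs a target defined on all of `C`, hence the direct
  -- image. The functional on `W` is recovered afterwards, since the trace of any `V ≤ W` is `V`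
  -- itself.
  let g : canonicalSheaf f ⟶ directImage W :=
    associatedSheafDesc ((PresheafOfModules.DifferentialsConstruction.isUniversal'
      (scalarsHom f)).desc (directImageDerivation f D hD hc))
  have hg : ∀ a : Γ(C, W), g.app W (toSheafification
        (PresheafOfModules.DifferentialsConstruction.relativeDifferentials' (scalarsHom f)) W
        (CommRingCat.KaehlerDifferential.d (f := scalars f W) a)) =
      D (trace W W) (trace_le_left _ _) (C.presheaf.map (homOfLE (trace_le_right W W)).op a) := by
    intro a
    refine (associatedSheafDesc_app _ _ _).trans ?_
    exact PresheafOfModules.Derivation.congr_d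
      ((PresheafOfModules.DifferentialsConstruction.isUniversal' (scalarsHom f)).fac
        (directImageDerivation f D hD hc)) (X := op W) a
  refine ⟨⟨fun V hV =>
    { toFun := fun m => C.presheaf.map (homOfLE (le_trace hV)).op (g.app V m : Γ(C, trace W V))
      map_add' := fun m n => ?_
      map_smul' := fun r m => ?_ }, fun U V hU hV m => ?_⟩, fun a => ?_⟩
  · rw [map_add]
    exact map_add (C.presheaf.map (homOfLE (le_trace hV)).op).hom
      (g.app V m : Γ(C, trace W V)) (g.app V n : Γ(C, trace W V))
  · rw [Scheme.Modules.Hom.app_smul, directImage_smul]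
    refine (map_mul (C.presheaf.map (homOfLE (le_trace hV)).op).hom _ _).trans ?_
    refine congrArg₂ (fun x y : Γ(C, V) => x * y) ?_ rfl
    refine (map_map (le_trace hV) (trace_le_right W V) r).trans ?_
    have e : (homOfLE ((le_trace hV).trans (trace_le_right W V))).op = 𝟙 (op V) := rfl
    rw [e, CategoryTheory.Functor.map_id]
    rfl
  · change C.presheaf.map (homOfLE (le_trace (hV.trans hU))).op
      (g.app V ((canonicalSheaf f).presheaf.map (homOfLE hV).op m) : Γ(C, trace W V)) =
      C.presheaf.map (homOfLE hV).op (C.presheaf.map (homOfLE (le_trace hU)).op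
        (g.app U m : Γ(C, trace W U)))
    rw [hom_map]
    exact (map_map (X := C) (le_trace (hV.trans hU))
      (Scheme.Hom.image_mono _ (W.ι.preimage_mono hV)) (g.app U m : Γ(C, trace W U))).trans
      (map_map (X := C) hV (le_trace hU) (g.app U m : Γ(C, trace W U))).symm
  · refine (congrArg (C.presheaf.map (homOfLE (le_trace (le_refl W))).op) (hg a)).trans ?_
    rw [hD W _ le_rfl]
    refine (map_map _ _ _).trans ?_
    have e : (homOfLE ((le_trace (le_refl W)).trans (trace_le_right W W))).op = 𝟙 (op W) := rfl
    rw [e, CategoryTheory.Functor.map_id]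
    rfl

end

/-! ### The local pairing of `K_C` with `T_C` on a smooth curve. -/

section

/-- The differentials are free of rank one, so a basis is nonempty; a basis vector and its
coordinate function do the job. -/
lemma exists_kaehlerDifferential_functional {R A : Type} [CommRing R] [CommRing A] [Algebra R A]
    [Nontrivial A] [Algebra.IsStandardSmoothOfRelativeDimension 1 R A] :
    ∃ (ω : Ω[A⁄R]) (c : Ω[A⁄R] →ₗ[A] A), c ω = 1 := by
  have := Algebra.IsStandardSmoothOfRelativeDimension.isStandardSmooth (R := R) (S := A) 1
  have hr : Module.rank A Ω[A⁄R] = (1 : ℕ) :=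
    Algebra.IsStandardSmoothOfRelativeDimension.rank_kaehlerDifferential 1
  let b := Module.Free.chooseBasis A Ω[A⁄R]
  have : Nonempty (Module.Free.ChooseBasisIndex A Ω[A⁄R]) := by
    by_contra h
    rw [not_nonempty_iff] at h
    rw [← b.mk_eq_rank''] at hr
    simp at hr
  obtain ⟨i⟩ := this
  exact ⟨b i, b.coord i, by simp⟩

lemma toSheafification_smul {X : Scheme.{0}} (P : X.PresheafOfModules) (U : X.Opens) (r : Γ(X, U))
    (p : P.obj (op U)) :
    toSheafification P U ((show X.ringCatSheaf.obj.obj (op U) from r) • p) =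
      r • toSheafification P U p :=
  (((PresheafOfModules.sheafificationAdjunction
    (𝟙 X.ringCatSheaf.obj)).unit.app P).app (op U)).hom.map_smul r p

variable {C : Scheme.{0}} (f : C ⟶ Spec (.of ℂ))

/-- Smoothness gives a standard smooth chart over some affine open set of `Spec ℂ`. As `Spec ℂ` is a
single point, that open set is everything, and its ring of functions is `ℂ`. -/
lemma exists_isStandardSmooth_scalars [SmoothOfRelativeDimension 1 f] (x : C) :
    ∃ W : C.Opens, IsAffineOpen W ∧ x ∈ W ∧
      (scalars f W).hom.IsStandardSmoothOfRelativeDimension 1 := by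
  obtain ⟨U, hU, V, hV, hx, e, hs⟩ :=
    SmoothOfRelativeDimension.exists_isStandardSmoothOfRelativeDimension (n := 1) (f := f) x
  obtain rfl : U = ⊤ := by
    refine top_le_iff.1 fun y _ => ?_
    have : Subsingleton (Spec (.of ℂ)) := inferInstanceAs (Subsingleton (PrimeSpectrum ℂ))
    rw [Subsingleton.elim y (f x)]
    exact e hx
  refine ⟨V, hV, hx, ?_⟩
  have h : scalars f V = (Scheme.ΓSpecIso (.of ℂ)).inv ≫ f.appLE ⊤ V e := rfl
  rw [h]
  exact (RingHom.isStandardSmoothOfRelativeDimension_respectsIso (n := 1)).2 _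
    (Scheme.ΓSpecIso (.of ℂ)).symm.commRingCatIsoToRingEquiv hs

/-- On a smooth curve, locally some section of `K_C` pairs to `1` with some section of `T_C`. -/
lemma exists_canonicalSheaf_pairing_eq_one [SmoothOfRelativeDimension 1 f] (x : C) :
    ∃ (W : C.Opens) (k : Γ(canonicalSheaf f, W)) (v : DualSection (canonicalSheaf f) W),
      x ∈ W ∧ v.app W le_rfl k = 1 := by
  obtain ⟨W, hW, hxW, hs⟩ := exists_isStandardSmooth_scalars f x
  have : Nonempty W := ⟨⟨x, hxW⟩⟩
  algebraize [(scalars f W).hom]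
  obtain ⟨ω, c, hω⟩ := exists_kaehlerDifferential_functional (R := CommRingCat.of ℂ) (A := Γ(C, W))
  -- The extension is made over `ℤ`. Compatibility with `ℂ` only requires that constants on `W` be
  -- killed, which `c ∘ d` does.
  obtain ⟨D, hD, hDW⟩ := exists_derivation_extension hW
    ((c.compDer (KaehlerDifferential.D (CommRingCat.of ℂ) Γ(C, W))).restrictScalars ℤ)
  obtain ⟨v, hv⟩ := exists_dualSection_of_derivation f D hD (fun z => by
    rw [hDW]
    exact (c.compDer (KaehlerDifferential.D (CommRingCat.of ℂ) Γ(C, W))).map_algebraMap z)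
  let P := PresheafOfModules.DifferentialsConstruction.relativeDifferentials' (scalarsHom f)
  let L : Ω[Γ(C, W)⁄CommRingCat.of ℂ] →ₗ[Γ(C, W)] Γ(C, W) :=
    { toFun := fun w => v.app W le_rfl (toSheafification P W w)
      map_add' := fun a b => (congrArg _ (toSheafification_add P W a b)).trans (map_add _ _ _)
      map_smul' := fun r a => (congrArg _ (toSheafification_smul P W r a)).trans (map_smul _ _ _) }
  -- The section `v` is known only on exact differentials `da`. These generate the differentials of
  -- `Γ(C, W)`, so `v` agrees with `c` on `ω` as well.
  have hL : L = c := Derivation.liftKaehlerDifferential_unique _ _ (by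
    ext a
    exact (hv a).trans (by rw [hDW]; rfl))
  exact ⟨W, toSheafification P W ω, v, hxW, (congrArg (fun l => l ω) hL).trans hω⟩

end

end CurveBundles

end

theorem mainTheorem6
    (C : AlgebraicGeometry.Scheme.{0})
    (f : C ⟶ AlgebraicGeometry.Spec (.of ℂ))
    [AlgebraicGeometry.IsIntegral C] [AlgebraicGeometry.IsProper f]
    [AlgebraicGeometry.SmoothOfRelativeDimension 1 f]
    (r : ℕ) (E : C.Modules) (hE : CurveBundles.IsVectorBundle E r)
    (hgE : CurveBundles.IsGloballyGenerated E)
    (hgKE : CurveBundles.IsGloballyGenerated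
      (CurveBundles.tensor (CurveBundles.canonicalSheaf f) (CurveBundles.dual E)))
    (s : Module.Basis (Fin (r + 1)) ℂ (CurveBundles.H0 f E))
    (m : ℕ)
    (t : Module.Basis (Fin m) ℂ (CurveBundles.H0 f
      (CurveBundles.tensor (CurveBundles.canonicalSheaf f) (CurveBundles.dual E)))) :
    Nonempty (CategoryTheory.Limits.image
        (CurveBundles.restrictToCurve f (CurveBundles.linearFormMatrix f E s t).transpose) ≅
      CurveBundles.dual E) :=
  CurveBundles.nonempty_image_iso_dual f
    (CurveBundles.exists_canonicalSheaf_pairing_eq_one f) hgE hgKE s t
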